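/- Let $(Q,\cdot,/,\backslash,e)$ be a loop: $e$ is a two-sided identity element, and $x\cdot(x\backslash y)=y$, $(y/x)\cdot x=y$, $x\backslash(x\cdot y)=y$, $(y\cdot x)/x=y$ for all $x,y\in Q$. Suppose that $Q$ is a conjugacy closed loop (CC-loop), i.e. for all $x,y,z\in Q$ $$x\cdot (yz)=((xy)/x)\cdot (xz)\quad\text{and}\quad (zy)\cdot x=(zx)\cdot (x\backslash(yx)).$$ Then $Q$ is diassociative (the subloop generated by any two of its elements is associative, i.e. a group) if and only if $Q$ is power associative (the subloop generated by any one of its elements is associative, i.e. a group) and $Q$ satisfies the identity $$(xy)(yy)=((xy)y)y\quad\text{for all }x,y\in Q,$$ that is, $Q$ is a $4^{1,3}_{12\cdot 22=(12\cdot 2)2}$ loop. -/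

import Mathlib

universe u

/-- A loop: a set with a two-sided identity element, a multiplication, and left and right
divisions `ldiv x y = x \ y` and `rdiv x y = x / y` inverting the translations. -/
class Loop (Q : Type u) extends MulOneClass Q where
  /-- `ldiv x y` is `x \ y`, the unique `z` with `x * z = y`. -/
  ldiv : Q → Q → Q
  /-- `rdiv x y` is `x / y`, the unique `z` with `z * y = x`. -/
  rdiv : Q → Q → Q
  mul_ldiv : ∀ x y : Q, x * ldiv x y = y
  rdiv_mul : ∀ x y : Q, rdiv y x * x = y
  ldiv_mul : ∀ x y : Q, ldiv x (x * y) = y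
  mul_rdiv : ∀ x y : Q, rdiv (y * x) x = y

namespace Loop

variable (Q : Type u) [Loop Q]

/-- A conjugacy closed loop: `x·yz = (xy)/x · xz` and `zy·x = zx · x\(yx)`. -/
def IsCC : Prop :=
  (∀ x y z : Q, x * (y * z) = rdiv (x * y) x * (x * z)) ∧
  (∀ x y z : Q, (z * y) * x = (z * x) * ldiv x (y * x))

/-- A subloop: a subset containing the identity and closed under multiplication and both
divisions. -/
structure Subloop extends Submonoid Q where
  ldiv_mem : ∀ {x y : Q}, x ∈ carrier → y ∈ carrier → ldiv x y ∈ carrier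
  rdiv_mem : ∀ {x y : Q}, x ∈ carrier → y ∈ carrier → rdiv x y ∈ carrier

variable {Q}

/-- The subloop generated by a set: the intersection of all subloops containing it. -/
def closure (S : Set Q) : Subloop Q where
  carrier := {x | ∀ H : Subloop Q, S ⊆ H.carrier → x ∈ H.carrier}
  one_mem' := fun H _ => H.one_mem'
  mul_mem' := fun hx hy H hS => H.mul_mem' (hx H hS) (hy H hS)
  ldiv_mem := fun hx hy H hS => H.ldiv_mem (hx H hS) (hy H hS)
  rdiv_mem := fun hx hy H hS => H.rdiv_mem (hx H hS) (hy H hS)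

/-- A subloop is associative (equivalently, it is a group). -/
def Subloop.IsAssoc (H : Subloop Q) : Prop :=
  ∀ a ∈ H.carrier, ∀ b ∈ H.carrier, ∀ c ∈ H.carrier, (a * b) * c = a * (b * c)

variable (Q)

/-- Every element generates an associative subloop. -/
def IsPowerAssociative : Prop :=
  ∀ x : Q, (closure ({x} : Set Q)).IsAssoc

/-- Every two elements generate an associative subloop. -/
def IsDiassociative : Prop :=
  ∀ x y : Q, (closure ({x, y} : Set Q)).IsAssoc

/-- The weak diassociativity law `4_{12·22=(12·2)2}^{1,3}`, that is, `xy·yy = (xy·y)y`. -/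
def IsFour_12_22_eq_12_2_2 : Prop :=
  ∀ x y : Q, (x * y) * (y * y) = ((x * y) * y) * y

end Loop

/-! Since `x * y` is arbitrary, the four-variable law is the right alternative law. With conjugacy
closure it gives flexibility, then the middle Moufang identity, and in a CC Moufang loop every
square is nuclear. Hence, modulo nuclear factors, each element is its own inverse and products
commute, so `x`, `y` and the nucleus generate only the classes of `1`, `x`, `y`, `x * y`. Nuclear
factors do not affect whether a triple associates, so associativity reduces to finitely many triples
of representatives. -/

namespace Loop

variable {Q : Type*} [Loop Q]

/-- The right inverse of an element. -/
def inv (x : Q) : Q := ldiv x 1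

/-- The middle Moufang identity. -/
def IsMoufang (Q : Type*) [Loop Q] : Prop :=
  ∀ x u v : Q, (x * u) * (v * x) = (x * (u * v)) * x

theorem mul_left_cancel' {x a b : Q} (h : x * a = x * b) : a = b := by
  rw [← ldiv_mul x a, h, ldiv_mul]

theorem mul_right_cancel' {x a b : Q} (h : a * x = b * x) : a = b := by
  rw [← mul_rdiv x a, h, mul_rdiv]

theorem IsFour_12_22_eq_12_2_2.right_alternative (h : IsFour_12_22_eq_12_2_2 Q) (u y : Q) :
    u * (y * y) = (u * y) * y := by
  have := h (rdiv u y) y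
  rwa [rdiv_mul] at this

/-- A right alternative conjugacy closed loop is flexible. -/
theorem IsCC.flexible (hQ : IsCC Q) (hr : IsFour_12_22_eq_12_2_2 Q) (x v : Q) :
    x * (v * x) = (x * v) * x := by
  rw [hQ.1 x v x, hr.right_alternative, rdiv_mul]

/-- A right alternative conjugacy closed loop is Moufang. -/
theorem IsCC.isMoufang (hQ : IsCC Q) (hr : IsFour_12_22_eq_12_2_2 Q) : IsMoufang Q := by
  intro x u v
  rw [hQ.1 x u v, hQ.2 x, rdiv_mul, ← hQ.flexible hr x v, ldiv_mul]

/-! ### Inverses, the Bol identity and the alternative laws. -/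

namespace IsMoufang

theorem flexible (h : IsMoufang Q) (x v : Q) : (x * v) * x = x * (v * x) := by
  have := h x 1 v
  rwa [mul_one, one_mul, eq_comm] at this

theorem mul_inv_cancel (x : Q) : x * inv x = 1 := mul_ldiv x 1

theorem inv_mul_cancel (h : IsMoufang Q) (x : Q) : inv x * x = 1 := by
  apply mul_left_cancel' (x := x)
  rw [← h.flexible, mul_inv_cancel, one_mul, mul_one]

theorem mul_inv_cancel_left (h : IsMoufang Q) (x v : Q) : x * (inv x * v) = v := by
  apply mul_right_cancel' (x := x)
  rw [← h, mul_inv_cancel, one_mul]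

theorem inv_mul_cancel_left (h : IsMoufang Q) (x v : Q) : inv x * (x * v) = v := by
  apply mul_left_cancel' (x := x)
  rw [h.mul_inv_cancel_left]

theorem inv_mul_cancel_right (h : IsMoufang Q) (x v : Q) : (v * inv x) * x = v := by
  apply mul_left_cancel' (x := x)
  rw [← h.flexible, ← h, h.inv_mul_cancel, mul_one]

theorem mul_inv_cancel_right (h : IsMoufang Q) (x v : Q) : (v * x) * inv x = v := by
  apply mul_right_cancel' (x := x)
  rw [h.inv_mul_cancel_right]

theorem inv_inv (h : IsMoufang Q) (x : Q) : inv (inv x) = x := by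
  apply mul_left_cancel' (x := inv x)
  rw [mul_inv_cancel, h.inv_mul_cancel]

theorem inv_mul_rev (h : IsMoufang Q) (a b : Q) : inv (a * b) = inv b * inv a := by
  have h1 : inv (a * b) * a = inv b := by
    conv_lhs => rw [← h.mul_inv_cancel_right b a]
    rw [h.mul_inv_cancel_right b a, ← h.inv_mul_cancel_left (a * b) (inv b),
      h.mul_inv_cancel_right]
  rw [← h1, h.mul_inv_cancel_right]

theorem ldiv_eq (h : IsMoufang Q) (a b : Q) : ldiv a b = inv a * b := by
  apply mul_left_cancel' (x := a)
  rw [mul_ldiv, h.mul_inv_cancel_left]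

theorem rdiv_eq (h : IsMoufang Q) (a b : Q) : rdiv a b = a * inv b := by
  apply mul_right_cancel' (x := b)
  rw [rdiv_mul, h.inv_mul_cancel_right]

/-- The right Bol identity. -/
theorem right_bol (h : IsMoufang Q) (w x y : Q) : ((w * x) * y) * x = w * (x * (y * x)) := by
  -- Chosen so that `u * v = y` and `x * u = inv w`.
  have key := h x (inv (w * x)) ((w * x) * y)
  rw [h.inv_mul_cancel_left, h.inv_mul_rev, h.mul_inv_cancel_left] at key
  rw [← h.flexible, ← key, h.mul_inv_cancel_left]

theorem right_alternative (h : IsMoufang Q) (w x : Q) : (w * x) * x = w * (x * x) := by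
  simpa using h.right_bol w x 1

/-- Inversion reverses products, so it exchanges the two alternative laws. -/
theorem left_alternative (h : IsMoufang Q) (x w : Q) : (x * x) * w = x * (x * w) := by
  have := congrArg inv (h.right_alternative (inv w) (inv x))
  simpa only [h.inv_mul_rev, h.inv_inv, eq_comm] using this

end IsMoufang

/-- Elements that associate with every pair of elements, in every position. -/
structure IsNuclear (n : Q) : Prop where
  left : ∀ a b, (n * a) * b = n * (a * b)
  middle : ∀ a b, (a * n) * b = a * (n * b)
  right : ∀ a b, (a * b) * n = a * (b * n)

namespace IsNuclear

theorem one : IsNuclear (1 : Q) := ⟨by simp, by simp, by simp⟩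

theorem mul {m n : Q} (hm : IsNuclear m) (hn : IsNuclear n) : IsNuclear (m * n) where
  left a b := by rw [hm.left, hm.left, hn.left, hm.left]
  middle a b := by rw [← hm.middle, hn.middle, hm.middle, hm.left]
  right a b := by rw [← hm.middle, hm.right, hn.right, hm.middle]

theorem inv (h : IsMoufang Q) {n : Q} (hn : IsNuclear n) : IsNuclear (inv n) where
  left a b := by
    apply mul_left_cancel' (x := n)
    rw [← hn.left, h.mul_inv_cancel_left, h.mul_inv_cancel_left]
  middle a b := by
    have := hn.middle (a * Loop.inv n) (Loop.inv n * b)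
    rw [h.inv_mul_cancel_right, h.mul_inv_cancel_left] at this
    exact this.symm
  right a b := by
    apply mul_right_cancel' (x := n)
    rw [h.inv_mul_cancel_right, hn.right, h.inv_mul_cancel_right]

/-- In a Moufang loop an element of the middle nucleus lies in the nucleus. -/
theorem of_middle (h : IsMoufang Q) {n : Q} (hn : ∀ a b, (a * n) * b = a * (n * b)) :
    IsNuclear n where
  left a b := by
    -- The left side collapses to `b`, giving `b = inv (n * a) * (n * (a * b))`.
    have h2 := hn (Loop.inv a * Loop.inv n) (a * b)
    rw [h.inv_mul_cancel_right, h.inv_mul_cancel_left, ← h.inv_mul_rev] at h2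
    conv_lhs => rw [h2]
    rw [h.mul_inv_cancel_left]
  middle := hn
  right a b := by
    have h2 := hn (a * b) (Loop.inv n * Loop.inv b)
    rw [h.mul_inv_cancel_left, h.mul_inv_cancel_right, ← h.inv_mul_rev] at h2
    conv_rhs => rw [← h2]
    rw [h.inv_mul_cancel_right]

end IsNuclear

/-- In a conjugacy closed Moufang loop all squares are nuclear. -/
theorem IsCC.isNuclear_mul_self (hQ : IsCC Q) (h : IsMoufang Q) (x : Q) : IsNuclear (x * x) := by
  apply IsNuclear.of_middle h
  intro w v
  -- With this `y`, the right CC law turns `((w * x) * x) * v` into `((w * x) * y) * x`, to which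
  -- right Bol applies.
  obtain ⟨y, hy⟩ : ∃ y, y * x = x * v := ⟨rdiv (x * v) x, rdiv_mul _ _⟩
  have hv : ldiv x (y * x) = v := by rw [hy, ldiv_mul]
  rw [← h.right_alternative, ← hv, ← hQ.2 x y (w * x), hv, h.right_bol, h.left_alternative, hy]

/-- Two elements are equivalent if they differ by a nuclear factor on the left. -/
def NuclearEquiv (a b : Q) : Prop := ∃ n : Q, IsNuclear n ∧ a = n * b

/-- The triple `a, b, c` associates. -/
def Associates (a b c : Q) : Prop := (a * b) * c = a * (b * c)

/-! ### Calculation modulo the nucleus. -/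

namespace NuclearEquiv

theorem refl (a : Q) : NuclearEquiv a a := ⟨1, .one, (one_mul a).symm⟩

theorem trans {a b c : Q} (hab : NuclearEquiv a b) (hbc : NuclearEquiv b c) :
    NuclearEquiv a c := by
  obtain ⟨m, hm, rfl⟩ := hab
  obtain ⟨n, hn, rfl⟩ := hbc
  exact ⟨m * n, hm.mul hn, (hm.left _ _).symm⟩

theorem nuclear_mul {n : Q} (hn : IsNuclear n) (a : Q) : NuclearEquiv (n * a) a := ⟨n, hn, rfl⟩

variable (h : IsMoufang Q) (hs : ∀ x : Q, IsNuclear (x * x))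

include h hs

theorem inv_self (a : Q) : NuclearEquiv (inv a) a :=
  ⟨inv a * inv a, hs _, (h.inv_mul_cancel_right a (inv a)).symm⟩

/-- Plays the role of normality of the nucleus: up to the nuclear square of `a * n`, the product
equals its inverse `inv n * inv a`, where the nuclear factor is on the left. -/
theorem mul_nuclear {n : Q} (hn : IsNuclear n) (a : Q) : NuclearEquiv (a * n) a := by
  have h1 : a * n = ((a * n) * (a * n)) * (inv n * inv a) := by
    rw [← h.inv_mul_rev, h.mul_inv_cancel_right]
  rw [h1]
  exact (nuclear_mul (hs _) _).trans ((nuclear_mul (hn.inv h) _).trans (inv_self h hs a))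

theorem mul {a b c d : Q} (hac : NuclearEquiv a c) (hbd : NuclearEquiv b d) :
    NuclearEquiv (a * b) (c * d) := by
  obtain ⟨m, hm, rfl⟩ := hac
  obtain ⟨n, hn, rfl⟩ := hbd
  obtain ⟨k, hk, e⟩ := mul_nuclear h hs hn c
  refine ⟨m * k, hm.mul hk, ?_⟩
  rw [hm.left, ← hn.middle, e, hk.left, hm.left]

theorem mul_comm (a b : Q) : NuclearEquiv (a * b) (b * a) := by
  have h1 : a * b = ((a * b) * (a * b)) * (inv b * inv a) := by
    rw [← h.inv_mul_rev, h.mul_inv_cancel_right]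
  rw [h1]
  exact (nuclear_mul (hs _) _).trans (mul h hs (inv_self h hs b) (inv_self h hs a))

theorem mul_self_mul (a b : Q) : NuclearEquiv (a * (a * b)) b := by
  rw [← h.left_alternative]
  exact nuclear_mul (hs _) _

/-- A nuclear factor of the second or third entry passes to the entry before it, and from the first
entry it pulls out of both bracketings. -/
theorem associates {a b c a' b' c' : Q} (ha : NuclearEquiv a a') (hb : NuclearEquiv b b')
    (hc : NuclearEquiv c c') (H : Associates a' b' c') : Associates a b c := by
  have first : ∀ {a b c n : Q}, IsNuclear n → Associates a b c → Associates (n * a) b c := by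
    intro a b c n hn H
    rw [Associates] at *
    rw [hn.left, hn.left, hn.left, H]
  have second : ∀ {a b c n : Q}, IsNuclear n → Associates a b c → Associates a (n * b) c := by
    intro a b c n hn H
    obtain ⟨k, hk, e⟩ := mul_nuclear h hs hn a
    have := first hk H
    rw [Associates] at *
    rw [← hn.middle, e, this, ← e, hn.middle, hn.left]
  have third : ∀ {a b c n : Q}, IsNuclear n → Associates a b c → Associates a b (n * c) := by
    intro a b c n hn H
    obtain ⟨k, hk, e⟩ := mul_nuclear h hs hn b
    have := second hk H
    rw [Associates] at *
    rw [← hn.middle, hn.right, e, this, ← e, hn.middle]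
  obtain ⟨m, hm, rfl⟩ := ha
  obtain ⟨n, hn, rfl⟩ := hb
  obtain ⟨k, hk, rfl⟩ := hc
  exact first hm (second hn (third hk H))

end NuclearEquiv

/-! ### An associative subloop containing two given elements. -/

namespace IsMoufang

open NuclearEquiv

/-- Elements equivalent to one of `1, x, y, x * y`. -/
def NuclearSpan (x y c : Q) : Prop :=
  NuclearEquiv c 1 ∨ NuclearEquiv c x ∨ NuclearEquiv c y ∨ NuclearEquiv c (x * y)

variable (h : IsMoufang Q) (hs : ∀ x : Q, IsNuclear (x * x))

include h hs

theorem nuclearSpan_mul {x y a b : Q} (ha : NuclearSpan x y a) (hb : NuclearSpan x y b) :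
    NuclearSpan x y (a * b) := by
  have sq (c : Q) : NuclearEquiv (c * c) 1 := by simpa using mul_self_mul h hs c 1
  have hxxy := mul_self_mul h hs x y
  have hyxy : NuclearEquiv (y * (x * y)) x :=
    (mul h hs (refl y) (mul_comm h hs x y)).trans (mul_self_mul h hs y x)
  rcases ha with ha | ha | ha | ha <;> rcases hb with hb | hb | hb | hb <;>
    have hab := mul h hs ha hb
  · exact .inl (by simpa using hab)
  · exact .inr (.inl (by simpa using hab))
  · exact .inr (.inr (.inl (by simpa using hab)))
  · exact .inr (.inr (.inr (by simpa using hab)))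
  · exact .inr (.inl (by simpa using hab))
  · exact .inl (hab.trans (sq x))
  · exact .inr (.inr (.inr hab))
  · exact .inr (.inr (.inl (hab.trans hxxy)))
  · exact .inr (.inr (.inl (by simpa using hab)))
  · exact .inr (.inr (.inr (hab.trans (mul_comm h hs y x))))
  · exact .inl (hab.trans (sq y))
  · exact .inr (.inl (hab.trans hyxy))
  · exact .inr (.inr (.inr (by simpa using hab)))
  · exact .inr (.inr (.inl (hab.trans ((mul_comm h hs _ _).trans hxxy))))
  · exact .inr (.inl (hab.trans ((mul_comm h hs _ _).trans hyxy)))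
  · exact .inl (hab.trans (sq _))

theorem nuclearSpan_inv {x y a : Q} (ha : NuclearSpan x y a) : NuclearSpan x y (inv a) :=
  have e := inv_self h hs a
  ha.imp e.trans (Or.imp e.trans (Or.imp e.trans e.trans))

/-- The subloop generated by `x`, `y` and the nucleus. -/
def nuclearSpan (x y : Q) : Subloop Q where
  carrier := {c | NuclearSpan x y c}
  one_mem' := .inl (refl 1)
  mul_mem' ha hb := h.nuclearSpan_mul hs ha hb
  ldiv_mem {a b} ha hb := by
    rw [h.ldiv_eq]
    exact h.nuclearSpan_mul hs (h.nuclearSpan_inv hs ha) hb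
  rdiv_mem {a b} ha hb := by
    rw [h.rdiv_eq]
    exact h.nuclearSpan_mul hs ha (h.nuclearSpan_inv hs hb)

/-- Triples containing `1` or a repeated entry associate by the unit, alternative and flexible laws.
The remaining ones are the six orderings of `x`, `y`, `x * y`. -/
theorem nuclearSpan_isAssoc (x y : Q) : (h.nuclearSpan hs x y).IsAssoc := by
  have one_left (a b : Q) : Associates 1 a b := by simp [Associates]
  have one_middle (a b : Q) : Associates a 1 b := by simp [Associates]
  have one_right (a b : Q) : Associates a b 1 := by simp [Associates]
  have aab (a b : Q) : Associates a a b := h.left_alternative a b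
  have abb (a b : Q) : Associates a b b := h.right_alternative a b
  have aba (a b : Q) : Associates a b a := h.flexible a b
  have comm := mul_comm h hs
  have ab_ba (a b : Q) : Associates a b (b * a) := by
    rw [Associates, h, ← h.left_alternative, h.flexible]
  have ba_ab (a b : Q) : Associates (b * a) a b := by
    rw [Associates, h, h.right_alternative]
  have ab_ab (a b : Q) : Associates a b (a * b) :=
    associates h hs (refl _) (refl _) (comm a b) (ab_ba a b)
  have ab_left (a b : Q) : Associates (a * b) a b :=
    associates h hs (comm a b) (refl _) (refl _) (ba_ab a b)
  have a_ab_b (a b : Q) : Associates a (a * b) b := by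
    -- The third entry `a * (a * b)` is `b` up to the nuclear factor `a * a`.
    have := ab_ab a (a * b)
    rw [← h.left_alternative] at this
    refine associates h hs (refl _) (refl _) ⟨inv (a * a), (hs a).inv h, ?_⟩ this
    rw [h.inv_mul_cancel_left]
  have b_ab_a (a b : Q) : Associates b (a * b) a :=
    associates h hs (refl _) (comm a b) (refl _) (a_ab_b b a)
  intro a ha b hb c hc
  change Associates a b c
  rcases ha with ha | ha | ha | ha <;> rcases hb with hb | hb | hb | hb <;>
    rcases hc with hc | hc | hc | hc <;> refine associates h hs ha hb hc ?_ <;>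
    first
    | exact one_left _ _
    | exact one_middle _ _
    | exact one_right _ _
    | exact aab _ _
    | exact abb _ _
    | exact aba _ _
    | exact ab_ab _ _
    | exact ab_ba _ _
    | exact ab_left _ _
    | exact ba_ab _ _
    | exact a_ab_b _ _
    | exact b_ab_a _ _

theorem isDiassociative : IsDiassociative Q := by
  intro x y a ha b hb c hc
  have sub : ({x, y} : Set Q) ⊆ (h.nuclearSpan hs x y).carrier := by
    rintro z (rfl | rfl)
    · exact .inr (.inl (refl _))
    · exact .inr (.inr (.inl (refl _)))
  exact h.nuclearSpan_isAssoc hs x y a (ha _ sub) b (hb _ sub) c (hc _ sub)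

end IsMoufang

theorem IsDiassociative.isPowerAssociative (h : IsDiassociative Q) : IsPowerAssociative Q := by
  intro x
  simpa using h x x

theorem IsDiassociative.isFour (h : IsDiassociative Q) : IsFour_12_22_eq_12_2_2 Q := by
  intro x y
  have hx : x ∈ (closure ({x, y} : Set Q)).carrier := fun H hS => hS (by simp)
  have hy : y ∈ (closure ({x, y} : Set Q)).carrier := fun H hS => hS (by simp)
  exact (h x y _ ((closure {x, y}).mul_mem' hx hy) y hy y hy).symm

end Loop

theorem corollary1 (Q : Type*) [Loop Q] (hQ : Loop.IsCC Q) :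
    Loop.IsDiassociative Q ↔
      (Loop.IsPowerAssociative Q ∧ Loop.IsFour_12_22_eq_12_2_2 Q) := by
  refine ⟨fun h => ⟨h.isPowerAssociative, h.isFour⟩, fun ⟨_, hr⟩ => ?_⟩
  have h := hQ.isMoufang hr
  exact h.isDiassociative (hQ.isNuclear_mul_self h)
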